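/- **Setting.** Let $F$ be the free group on $x_1,\dots,x_q$, with lower central series $F_1=F$, $F_{k}=[F_{k-1},F]$. Let $k\ge 3$, let $W_1,\dots,W_t\in F_k$, let $R$ be the normal closure in $F$ of $W_1,\dots,W_t$ and $F_{k+1}$, and put $G=F/R$. For $1\le j\le q$ let $\alpha_j$ be the 1-cocycle on $G$ (and on $F/F_k$) with values in $\mathbb Z$ induced by the exponent sum of $x_j$. Let $\mathcal J_{k+1}$ be the two-sided ideal of the noncommutative polynomial ring $\mathbb Z\langle X_1,\dots,X_q\rangle$ generated by the monomials of degree $\ge k+1$, and let $\mathcal M:F\to(\mathbb Z\langle X_1,\dots,X_q\rangle/\mathcal J_{k+1})^{\times}$ be the Magnus expansion, the homomorphism with $\mathcal M(x_i)=1+X_i$. **Massey products.** Use inhomogeneous cochains with $(\partial a)(x,y)=a(y)-a(xy)+a(x)$ and $(u\smile v)(x,y)=-u(x)v(y)$ for 1-cochains. Fix $\varepsilon\in\{1,-1\}$ (the sign convention). For $n\ge 2$, a defining system for 1-cocycles $\gamma_1,\dots,\gamma_n$ consists of 1-cochains $a_{s,r}$ ($1\le s\le r\le n$, $(s,r)\ne(1,n)$)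 with $a_{s,s}=\gamma_s$ and $\partial a_{s,r}=\varepsilon\sum_{s\le i<r}a_{s,i}\smile a_{i+1,r}$. The Massey product $\langle\gamma_1,\dots,\gamma_n\rangle$ is the set of the classes in $H^2(\,\cdot\,;\mathbb Z)$ of the 2-cocycles $-\sum_{1\le i<n}a_{1,i}\smile a_{i+1,n}$, over all defining systems. With $\varepsilon=1$ the coefficients of the Magnus expansion form a defining system. **The 2-cycles.** Let $[W_j]\in H_2(G;\mathbb Z)$ be the class of $W_j$ under Hopf's isomorphism $H_2(G;\mathbb Z)\cong (R\cap[F,F])/[F,R]$, normalized as follows: if $z$ is an inhomogeneous 2-chain of $F$ with $\partial z=[1]-[W_j]$, where $\partial(x|y)=[y]-[xy]+[x]$, then the image of $z$ in the chains of $G$ is a cycle that represents $[W_j]$. Let $p:G\to F/F_k$ be the projection and $\mathcal W_j=p_*[W_j]\in H_2(F/F_k;\mathbb Z)$. **Theorem.** (1) For $2\le\ell<k$ and all $i_1,\dots,i_\ell$, the Massey product $\langle\alpha_{i_1},\dots,\alpha_{i_\ell}\rangle$ on $G$ is defined and vanishes: it is the set $\{0\}\subset H^2(G;\mathbb Z)$.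 (2) For all $j_1,\dots,j_k$, the $k$-fold Massey product $\langle\alpha_{j_1},\dots,\alpha_{j_k}\rangle$ is defined and consists of exactly one class, on $G$ as well as on $F/F_k$. For every $j$, in $\mathbb Z\langle X_1,\dots,X_q\rangle/\mathcal J_{k+1}$, $$\mathcal M(W_j)=1+\varepsilon^k\sum_{j_1,\dots,j_k}\bigl[\langle\alpha_{j_1},\dots,\alpha_{j_k}\rangle,\,W_j\bigr]\,X_{j_1}\cdots X_{j_k},$$ where $[\ ,\ ]$ denotes the evaluation of the Massey product on $G$ on $[W_j]\in H_2(G;\mathbb Z)$; the same formula holds with the evaluation of the Massey product on $F/F_k$ on $\mathcal W_j\in H_2(F/F_k;\mathbb Z)$. -/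

import Mathlib

/-- `ℤ` with the trivial action of `G`. -/
noncomputable abbrev trivZ (G : Type) [Group G] : Rep ℤ G := Rep.trivial ℤ G ℤ

/-! ### The free group, its lower central series, and the cocycles `α_j` -/

/-- The lower central series with the indexing `F_1 = F`, `F_k = [F_{k-1}, F]`, for the free group
`F` on `x_0, …, x_{q-1}` (only used for `k ≥ 1`). -/
def lcs (q k : ℕ) : Subgroup (FreeGroup (Fin q)) :=
  (⊤ : Subgroup (FreeGroup (Fin q))).lowerCentralSeries (k - 1)

instance lcs_normal (q k : ℕ) : (lcs q k).Normal := by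
  unfold lcs; infer_instance

/-- The normal closure `R` of `W_1, …, W_t` and `F_{k+1}` in the free group. -/
def relSubgroup {q t : ℕ} (k : ℕ) (W : Fin t → FreeGroup (Fin q)) :
    Subgroup (FreeGroup (Fin q)) :=
  Subgroup.normalClosure (Set.range W ∪ (lcs q (k + 1) : Set (FreeGroup (Fin q))))

instance relSubgroup_normal {q t : ℕ} (k : ℕ) (W : Fin t → FreeGroup (Fin q)) :
    (relSubgroup k W).Normal := by
  unfold relSubgroup; infer_instance

theorem relSubgroup_le_lcs {q t k : ℕ} {W : Fin t → FreeGroup (Fin q)}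
    (hW : ∀ j, W j ∈ lcs q k) : relSubgroup k W ≤ lcs q k := by
  refine Subgroup.normalClosure_le_normal (Set.union_subset ?_ ?_)
  · rintro _ ⟨j, rfl⟩
    exact hW j
  · exact Subgroup.lowerCentralSeries_antitone _ (by omega)

theorem lcs_le_commutator {q k : ℕ} (hk : 2 ≤ k) :
    lcs q k ≤ commutator (FreeGroup (Fin q)) := by
  rw [← Subgroup.top_lowerCentralSeries_one]
  exact Subgroup.lowerCentralSeries_antitone _ (by omega)

theorem relSubgroup_le_commutator {q t k : ℕ} (hk : 3 ≤ k) {W : Fin t → FreeGroup (Fin q)}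
    (hW : ∀ j, W j ∈ lcs q k) : relSubgroup k W ≤ commutator (FreeGroup (Fin q)) :=
  (relSubgroup_le_lcs hW).trans (lcs_le_commutator (le_of_lt hk))

/-- The exponent sum of the generator `x_j`: the `j`-th coordinate of the abelianization
`F → ℤ^q`. -/
def expSum {q : ℕ} (j : Fin q) : FreeGroup (Fin q) →* Multiplicative ℤ :=
  FreeGroup.lift fun i => Multiplicative.ofAdd (if i = j then 1 else 0)

theorem le_ker_expSum {q : ℕ} {N : Subgroup (FreeGroup (Fin q))}
    (hN : N ≤ commutator (FreeGroup (Fin q))) (j : Fin q) : N ≤ (expSum j).ker :=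
  hN.trans (Abelianization.commutator_subset_ker _)

/-- The `1`-cocycle `α_j : F/N → ℤ` induced by the exponent sum of `x_j`, for a normal subgroup
`N ≤ [F, F]`. -/
noncomputable def alpha {q : ℕ} (N : Subgroup (FreeGroup (Fin q))) [N.Normal]
    (hN : N ≤ commutator (FreeGroup (Fin q))) (j : Fin q) :
    groupCohomology.cocycles₁ (trivZ (FreeGroup (Fin q) ⧸ N)) :=
  ⟨fun g => (QuotientGroup.lift N (expSum j) (le_ker_expSum hN j) g).toAdd, by
    rw [groupCohomology.mem_cocycles₁_iff]
    intro g h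
    simp [add_comm]⟩

/-! ### Massey products of degree one classes -/

/-- The coboundary of an inhomogeneous `1`-cochain. -/
def cobound {G : Type} [Group G] (f : G → ℤ) : G × G → ℤ :=
  fun g => f g.2 - f (g.1 * g.2) + f g.1

/-- The cup product `C¹ × C¹ → C²`, with the sign `(-1)^{pq}` for `p = q = 1`. -/
def cup {G : Type} (u v : G → ℤ) : G × G → ℤ :=
  fun g => -(u g.1 * v g.2)

/-- Defining systems for `1`-cocycles `γ_1, …, γ_n`. The cochain `b s t` (for `0 ≤ s < t ≤ n`) is
the entry `a_{s+1,t}` of the usual notation, so that `b (i-1) i` is `γ_i`, and the equation reads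
`∂ a_{s,t} = ε ∑_{s ≤ r < t} a_{s,r} ⌣ a_{r+1,t}` for all `(s,t) ≠ (1,n)`. The unit `ε = ±1`
stands for the two sign conventions in use. Entries outside the range play no role. -/
structure IsDefiningSystem {G : Type} [Group G] (ε : ℤˣ) {n : ℕ}
    (γ : Fin n → groupCohomology.cocycles₁ (trivZ G))
    (b : Fin (n + 1) → Fin (n + 1) → G → ℤ) : Prop where
  diag : ∀ i : Fin n, b i.castSucc i.succ = (γ i : G → ℤ)
  cobound_eq : ∀ s t : Fin (n + 1), s < t → (s, t) ≠ (0, Fin.last n) →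
    cobound (b s t) = (ε : ℤ) • ∑ r ∈ Finset.Ioo s t, cup (b s r) (b r t)

/-- The cochain `-∑_{1 ≤ r < n} a_{1,r} ⌣ a_{r+1,n}` attached to a defining system. -/
def masseyCochain {G : Type} {n : ℕ} (b : Fin (n + 1) → Fin (n + 1) → G → ℤ) : G × G → ℤ :=
  -∑ r ∈ Finset.Ioo 0 (Fin.last n), cup (b 0 r) (b r (Fin.last n))

theorem IsDefiningSystem.masseyCochain_mem {G : Type} [Group G] {ε : ℤˣ} {n : ℕ}
    {γ : Fin n → groupCohomology.cocycles₁ (trivZ G)}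
    {b : Fin (n + 1) → Fin (n + 1) → G → ℤ} (hb : IsDefiningSystem ε γ b) :
    masseyCochain b ∈ groupCohomology.cocycles₂ (trivZ G) := by
  have key : ∀ s t : Fin (n + 1), s < t → (s, t) ≠ (0, Fin.last n) → ∀ x y : G,
      b s t (x * y) = b s t x + b s t y
        + ε * ∑ r ∈ Finset.Ioo s t, b s r x * b r t y := by
    intro s t hst hne x y
    have := congrFun (hb.cobound_eq s t hst hne) (x, y)
    simp only [cobound, cup, Pi.smul_apply, Finset.sum_apply, smul_eq_mul,
      Finset.sum_neg_distrib] at this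
    linarith
  have ev : ∀ x y : G, masseyCochain b (x, y)
      = ∑ r ∈ Finset.Ioo 0 (Fin.last n), b 0 r x * b r (Fin.last n) y := by
    intro x y
    simp [masseyCochain, cup]
  rw [groupCohomology.mem_cocycles₂_iff]
  intro x y z
  change masseyCochain b (x * y, z) + masseyCochain b (x, y)
    = masseyCochain b (y, z) + masseyCochain b (x, y * z)
  simp only [ev]
  have h1 : ∀ r ∈ Finset.Ioo 0 (Fin.last n),
      b 0 r (x * y) * b r (Fin.last n) z
        = b 0 r x * b r (Fin.last n) z + b 0 r y * b r (Fin.last n) z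
          + ε * ∑ s ∈ Finset.Ioo 0 r, b 0 s x * b s r y * b r (Fin.last n) z := by
    intro r hr
    rw [Finset.mem_Ioo] at hr
    rw [key 0 r hr.1 (by simp [hr.2.ne]), ← Finset.sum_mul]
    ring
  have h2 : ∀ s ∈ Finset.Ioo 0 (Fin.last n),
      b 0 s x * b s (Fin.last n) (y * z)
        = b 0 s x * b s (Fin.last n) y + b 0 s x * b s (Fin.last n) z
          + ε * ∑ r ∈ Finset.Ioo s (Fin.last n), b 0 s x * b s r y * b r (Fin.last n) z := by
    intro s hs
    rw [Finset.mem_Ioo] at hs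
    rw [key s (Fin.last n) hs.2 (by simp [hs.1.ne'])]
    simp only [mul_assoc, ← Finset.mul_sum]
    ring
  rw [Finset.sum_congr rfl h1, Finset.sum_congr rfl h2]
  simp only [Finset.sum_add_distrib, ← Finset.mul_sum]
  have h3 : ∑ r ∈ Finset.Ioo 0 (Fin.last n), ∑ s ∈ Finset.Ioo 0 r,
        b 0 s x * b s r y * b r (Fin.last n) z
      = ∑ s ∈ Finset.Ioo 0 (Fin.last n), ∑ r ∈ Finset.Ioo s (Fin.last n),
        b 0 s x * b s r y * b r (Fin.last n) z := by
    refine Finset.sum_comm' ?_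
    intro r s
    simp only [Finset.mem_Ioo]
    constructor
    · rintro ⟨⟨_, h⟩, h', h''⟩
      exact ⟨⟨h'', h⟩, h', h''.trans h⟩
    · rintro ⟨⟨h, h'⟩, h'', _⟩
      exact ⟨⟨h''.trans h, h'⟩, h'', h⟩
  rw [h3]
  ring

/-- The `n`-fold Massey product `⟨γ_1, …, γ_n⟩ ⊆ H²(G; ℤ)`: the set of the classes attached to all
defining systems. -/
def masseyProduct {G : Type} [Group G] (ε : ℤˣ) {n : ℕ}
    (γ : Fin n → groupCohomology.cocycles₁ (trivZ G)) :
    Set (groupCohomology.H2 (trivZ G)) :=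
  {c | ∃ (b : Fin (n + 1) → Fin (n + 1) → G → ℤ) (hb : IsDefiningSystem ε γ b),
    c = groupCohomology.H2π (trivZ G) ⟨masseyCochain b, hb.masseyCochain_mem⟩}

/-! ### The pairing of `H²(G; ℤ)` and `H₂(G; ℤ)` -/

/-- Evaluation of an inhomogeneous `2`-cochain on a `2`-chain. -/
def evalChain {G : Type} (f : G × G → ℤ) (z : G × G →₀ ℤ) : ℤ :=
  z.sum fun g n => n * f g

theorem evalChain_add_left {G : Type} (f f' : G × G → ℤ) (z : G × G →₀ ℤ) :
    evalChain (f + f') z = evalChain f z + evalChain f' z := by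
  simp [evalChain, mul_add, Finsupp.sum_add]

theorem evalChain_add_right {G : Type} (f : G × G → ℤ) (z z' : G × G →₀ ℤ) :
    evalChain f (z + z') = evalChain f z + evalChain f z' := by
  classical
  exact Finsupp.sum_add_index' (by simp) (by intros; ring)

theorem evalChain_sub_right {G : Type} (f : G × G → ℤ) (z z' : G × G →₀ ℤ) :
    evalChain f (z - z') = evalChain f z - evalChain f z' :=
  Finsupp.sum_sub_index (by intros; ring)

theorem evalChain_single {G : Type} (f : G × G → ℤ) (g : G × G) (n : ℤ) :
    evalChain f (Finsupp.single g n) = n * f g := by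
  simp [evalChain]

theorem evalChain_cobound {G : Type} [Group G] (u : G → ℤ) (z : G × G →₀ ℤ) :
    evalChain (cobound u) z
      = Finsupp.sum ((groupHomology.d₂₁ (trivZ G)).hom z : G →₀ ℤ) fun g n => n * u g := by
  induction z using Finsupp.induction_linear with
  | zero => simp [evalChain]
  | add z z' h h' =>
    rw [evalChain_add_right, h, h', map_add]
    exact (Finsupp.sum_add_index' (by simp) (by intros; ring)).symm
  | single g n =>
    rw [evalChain_single]
    have e : ((Finsupp.single g.2 n : G →₀ ℤ) - Finsupp.single (g.1 * g.2) n
        + Finsupp.single g.1 n).sum (fun g n => n * u g)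
        = n * u g.2 - n * u (g.1 * g.2) + n * u g.1 := by
      rw [Finsupp.sum_add_index' (by simp) (by intros; ring),
        Finsupp.sum_sub_index (by intros; ring)]
      simp
    refine Eq.trans ?_ ((congrArg (fun v : G →₀ ℤ => v.sum fun g n => n * u g)
      (groupHomology.d₂₁_single (A := trivZ G) g n)).trans e).symm
    simp only [cobound]
    ring

theorem evalChain_d₃₂ {G : Type} [Group G] {f : G × G → ℤ}
    (hf : f ∈ groupCohomology.cocycles₂ (trivZ G)) (w : G × G × G →₀ ℤ) :
    evalChain f ((groupHomology.d₃₂ (trivZ G)).hom w) = 0 := by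
  rw [groupCohomology.mem_cocycles₂_iff] at hf
  induction w using Finsupp.induction_linear with
  | zero => simp [evalChain]
  | add z z' h h' =>
    rw [map_add]
    exact (evalChain_add_right f _ _).trans (by rw [h, h', add_zero])
  | single g n =>
    have e : evalChain f ((Finsupp.single (g.2.1, g.2.2) n : G × G →₀ ℤ)
        - Finsupp.single (g.1 * g.2.1, g.2.2) n + Finsupp.single (g.1, g.2.1 * g.2.2) n
        - Finsupp.single (g.1, g.2.1) n)
        = n * f (g.2.1, g.2.2) - n * f (g.1 * g.2.1, g.2.2) + n * f (g.1, g.2.1 * g.2.2)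
        - n * f (g.1, g.2.1) := by
      rw [evalChain_sub_right, evalChain_add_right, evalChain_sub_right]
      simp [evalChain_single]
    refine ((congrArg (evalChain f) (groupHomology.d₃₂_single (A := trivZ G) g n)).trans
      e).trans ?_
    have h : f (g.1 * g.2.1, g.2.2) + f (g.1, g.2.1)
      = f (g.2.1, g.2.2) + f (g.1, g.2.1 * g.2.2) := hf g.1 g.2.1 g.2.2
    linear_combination -n * h

theorem evalChain_congr {G : Type} [Group G]
    {f f' : groupCohomology.cocycles₂ (trivZ G)} {z z' : groupHomology.cycles₂ (trivZ G)}
    (hf : groupCohomology.H2π (trivZ G) f = groupCohomology.H2π (trivZ G) f')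
    (hz : groupHomology.H2π (trivZ G) z = groupHomology.H2π (trivZ G) z') :
    evalChain f.1 z.1 = evalChain f'.1 z'.1 := by
  rw [groupCohomology.H2π_eq_iff] at hf
  rw [groupHomology.H2π_eq_iff] at hz
  obtain ⟨u, hu⟩ := hf
  obtain ⟨w, hw⟩ := hz
  have hf' : (f.1 : G × G → ℤ) = f'.1 + cobound (u : G → ℤ) := by
    have : cobound (u : G → ℤ) = (f.1 : G × G → ℤ) - f'.1 := hu
    rw [this]; abel
  have hz' : (z.1 : G × G →₀ ℤ) = z'.1 + (groupHomology.d₃₂ (trivZ G)).hom w := by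
    rw [hw]; abel
  have h0 : evalChain (cobound (u : G → ℤ)) z.1 = 0 := by
    rw [evalChain_cobound]
    have : (groupHomology.d₂₁ (trivZ G)).hom z.1 = 0 := z.2
    rw [this]
    exact Finsupp.sum_zero_index
  calc evalChain f.1 z.1 = evalChain f'.1 z.1 + evalChain (cobound (u : G → ℤ)) z.1 := by
        rw [← evalChain_add_left]; exact congrArg (evalChain · z.1) hf'
    _ = evalChain f'.1 z.1 := by rw [h0, add_zero]
    _ = evalChain f'.1 z'.1 + evalChain f'.1 ((groupHomology.d₃₂ (trivZ G)).hom w) := by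
        rw [← evalChain_add_right]; exact congrArg (evalChain f'.1) hz'
    _ = evalChain f'.1 z'.1 := by rw [evalChain_d₃₂ f'.2, add_zero]

theorem exists_cocycle {G : Type} [Group G] (c : groupCohomology.H2 (trivZ G)) :
    ∃ f : groupCohomology.cocycles₂ (trivZ G), groupCohomology.H2π (trivZ G) f = c :=
  groupCohomology.H2_induction_on c fun f => ⟨f, rfl⟩

theorem exists_cycle {G : Type} [Group G] (h : groupHomology.H2 (trivZ G)) :
    ∃ z : groupHomology.cycles₂ (trivZ G), groupHomology.H2π (trivZ G) z = h :=
  groupHomology.H2_induction_on h fun z => ⟨z, rfl⟩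

/-- The pairing `[c, h]` of `H²(G; ℤ)` and `H₂(G; ℤ)`, which evaluates a cocycle that represents
`c` on a cycle that represents `h` (see `pairing_mk` for independence of the choices). -/
noncomputable def pairing {G : Type} [Group G] (c : groupCohomology.H2 (trivZ G))
    (h : groupHomology.H2 (trivZ G)) : ℤ :=
  evalChain (exists_cocycle c).choose.1 (exists_cycle h).choose.1

theorem pairing_mk {G : Type} [Group G] (f : groupCohomology.cocycles₂ (trivZ G))
    (z : groupHomology.cycles₂ (trivZ G)) :
    pairing (groupCohomology.H2π (trivZ G) f) (groupHomology.H2π (trivZ G) z)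
      = evalChain f.1 z.1 :=
  evalChain_congr (exists_cocycle _).choose_spec (exists_cycle _).choose_spec

/-! ### Hopf's description of `H₂(F/N)` -/

/-- `h` is the class in `H₂(F/N; ℤ)` that corresponds to `w ∈ N ∩ [F, F]` under Hopf's isomorphism
`(N ∩ [F, F])/[F, N] ≅ H₂(F/N; ℤ)`: there is a `2`-chain `z` of `F` with `∂z = [1] - [w]`, and its
image in the chains of `F/N` is a cycle that represents `h`. For `w = ∏ [a_i, b_i]` and
`u_i = ∏_{l ≤ i} [a_l, b_l]`, such a chain is
`∑ ((u_{i-1} | a_i) + (u_{i-1} a_i | b_i) - (u_{i-1} a_i b_i a_i⁻¹ | a_i) - (u_i | b_i))`. -/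
def IsHopfClass {q : ℕ} (N : Subgroup (FreeGroup (Fin q))) [N.Normal] (w : FreeGroup (Fin q))
    (h : groupHomology.H2 (trivZ (FreeGroup (Fin q) ⧸ N))) : Prop :=
  ∃ (z : FreeGroup (Fin q) × FreeGroup (Fin q) →₀ ℤ)
    (c : groupHomology.cycles₂ (trivZ (FreeGroup (Fin q) ⧸ N))),
    (groupHomology.d₂₁ (trivZ (FreeGroup (Fin q)))).hom z
        = (Finsupp.single 1 1 - Finsupp.single w 1 : FreeGroup (Fin q) →₀ ℤ) ∧
    c.1 = z.mapDomain (Prod.map (QuotientGroup.mk' N) (QuotientGroup.mk' N)) ∧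
    groupHomology.H2π (trivZ (FreeGroup (Fin q) ⧸ N)) c = h

theorem d₂₁_mapDomain {G H : Type} [Group G] [Group H] (p : G →* H) (z : G × G →₀ ℤ) :
    ((groupHomology.d₂₁ (trivZ H)).hom (z.mapDomain (Prod.map p p)) : H →₀ ℤ)
      = Finsupp.mapDomain p ((groupHomology.d₂₁ (trivZ G)).hom z : G →₀ ℤ) := by
  induction z using Finsupp.induction_linear with
  | zero => simp only [Finsupp.mapDomain_zero, map_zero]
  | add z z' h h' =>
    rw [Finsupp.mapDomain_add, map_add, map_add]
    refine (congrArg₂ (· + ·) h h').trans ?_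
    exact Finsupp.mapDomain_add.symm
  | single g n =>
    rw [Finsupp.mapDomain_single]
    have e : Finsupp.mapDomain p ((Finsupp.single g.2 n : G →₀ ℤ) - Finsupp.single (g.1 * g.2) n
        + Finsupp.single g.1 n)
        = Finsupp.single (p g.2) n - Finsupp.single (p g.1 * p g.2) n
          + Finsupp.single (p g.1) n := by
      rw [sub_eq_add_neg, ← Finsupp.single_neg, Finsupp.mapDomain_add, Finsupp.mapDomain_add]
      simp only [Finsupp.mapDomain_single, map_mul]
      rw [Finsupp.single_neg, ← sub_eq_add_neg]
    exact (groupHomology.d₂₁_single (A := trivZ H) (Prod.map p p g) n).trans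
      ((congrArg (Finsupp.mapDomain p) (groupHomology.d₂₁_single (A := trivZ G) g n)).trans e).symm

theorem exists_chain_of_mem_commutator {G : Type} [Group G] {w : G} (hw : w ∈ commutator G) :
    ∃ z : G × G →₀ ℤ, (groupHomology.d₂₁ (trivZ G)).hom z
      = (Finsupp.single 1 1 - Finsupp.single w 1 : G →₀ ℤ) := by
  let B : Submodule ℤ (G →₀ ℤ) := LinearMap.range (groupHomology.d₂₁ (trivZ G)).hom
  have hB : ∀ g h : G, (Finsupp.single h 1 - Finsupp.single (g * h) 1 + Finsupp.single g 1 :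
      G →₀ ℤ) ∈ B := fun g h =>
    ⟨(Finsupp.single (g, h) 1 : G × G →₀ ℤ), groupHomology.d₂₁_single (A := trivZ G) (g, h) (1 : ℤ)⟩
  have h1 : (Finsupp.single 1 1 : G →₀ ℤ) ∈ B := by simpa using hB 1 1
  let φ : G →* Multiplicative ((G →₀ ℤ) ⧸ B) :=
    { toFun := fun g => Multiplicative.ofAdd (B.mkQ (Finsupp.single g 1))
      map_one' := by
        have : B.mkQ (Finsupp.single 1 1) = 0 := by simpa using h1
        rw [this]; rfl
      map_mul' := fun g h => by
        rw [← ofAdd_add, ← map_add]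
        congr 1
        have := hB g h
        rw [← B.ker_mkQ, LinearMap.mem_ker, map_add, map_sub] at this
        rw [map_add]
        rw [sub_add_eq_add_sub, sub_eq_zero] at this
        rw [← this, add_comm] }
  have hφ : φ w = 1 := Abelianization.commutator_subset_ker φ hw
  have hw1 : (Finsupp.single w 1 : G →₀ ℤ) ∈ B := by
    rw [← B.ker_mkQ]
    exact hφ
  exact B.sub_mem h1 hw1

theorem exists_isHopfClass {q : ℕ} (N : Subgroup (FreeGroup (Fin q))) [N.Normal]
    {w : FreeGroup (Fin q)} (hw : w ∈ N) (hw' : w ∈ commutator (FreeGroup (Fin q))) :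
    ∃ h, IsHopfClass N w h := by
  obtain ⟨z, hz⟩ := exists_chain_of_mem_commutator hw'
  refine ⟨_, z, ⟨z.mapDomain (Prod.map (QuotientGroup.mk' N) (QuotientGroup.mk' N)), ?_⟩, hz, rfl,
    rfl⟩
  change (groupHomology.d₂₁ (trivZ (FreeGroup (Fin q) ⧸ N))).hom _ = 0
  refine (d₂₁_mapDomain (QuotientGroup.mk' N) z).trans ?_
  have h1 : QuotientGroup.mk' N w = 1 := (QuotientGroup.eq_one_iff w).2 hw
  rw [hz, sub_eq_add_neg, ← Finsupp.single_neg, Finsupp.mapDomain_add, Finsupp.mapDomain_single,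
    Finsupp.mapDomain_single, map_one, h1, ← Finsupp.single_add]
  simp

/-- The homomorphism `p : F/N → F/N'` for `N ≤ N'`. -/
def quotProj {q : ℕ} (N N' : Subgroup (FreeGroup (Fin q))) [N.Normal] [N'.Normal] (h : N ≤ N') :
    FreeGroup (Fin q) ⧸ N →* FreeGroup (Fin q) ⧸ N' :=
  QuotientGroup.map N N' (MonoidHom.id _) h

/-- The map `p_* : H₂(G; ℤ) → H₂(H; ℤ)` induced by a homomorphism `p`. -/
noncomputable def pushH2 {G H : Type} [Group G] [Group H] (p : G →* H)
    (h : groupHomology.H2 (trivZ G)) : groupHomology.H2 (trivZ H) :=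
  groupHomology.map (A := trivZ G) (B := trivZ H) p (Rep.ofHom ⟨LinearMap.id, fun _ => rfl⟩) 2 h

/-! ### The Magnus expansion -/

/-- The noncommutative monomial `X_{w_1} ⋯ X_{w_n}`. -/
def ncMonomial {q : ℕ} (w : List (Fin q)) : FreeAlgebra ℤ (Fin q) :=
  (w.map (FreeAlgebra.ι ℤ)).prod

/-- The two-sided ideal `J_k` of `ℤ⟨X_1, …, X_q⟩` generated by the monomials of degree `≥ k`. -/
def degIdeal (q k : ℕ) : TwoSidedIdeal (FreeAlgebra ℤ (Fin q)) :=
  TwoSidedIdeal.span {p | ∃ w : List (Fin q), k ≤ w.length ∧ p = ncMonomial w}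

/-- `ℤ⟨X_1, …, X_q⟩ / J_k`. -/
abbrev TruncAlg (q k : ℕ) : Type := (degIdeal q k).ringCon.Quotient

/-- The class of `X_{w_1} ⋯ X_{w_n}` in `ℤ⟨X_1, …, X_q⟩ / J_k`. -/
def truncMonomial {q : ℕ} (k : ℕ) (w : List (Fin q)) : TruncAlg q k :=
  (degIdeal q k).ringCon.mk' (ncMonomial w)

theorem truncMonomial_singleton_pow {q : ℕ} (k : ℕ) (i : Fin q) :
    truncMonomial k [i] ^ k = 0 := by
  have h : ncMonomial [i] ^ k ∈ degIdeal q k :=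
    TwoSidedIdeal.subset_span ⟨List.replicate k i, by simp, by simp [ncMonomial]⟩
  rw [truncMonomial, ← map_pow, ← map_zero (degIdeal q k).ringCon.mk']
  exact Quotient.sound' ((degIdeal q k).rel_iff _ _ |>.2 (by simpa using h))

/-- The unit `1 + X_i`, with inverse `1 - X_i + X_i² - ⋯ + (-1)^{k-1} X_i^{k-1}`. -/
def magnusUnit {q : ℕ} (k : ℕ) (i : Fin q) : (TruncAlg q k)ˣ where
  val := 1 + truncMonomial k [i]
  inv := ∑ n ∈ Finset.range k, (-truncMonomial k [i]) ^ n
  val_inv := by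
    have := mul_neg_geom_sum (-truncMonomial k [i]) k
    rwa [sub_neg_eq_add, neg_pow, truncMonomial_singleton_pow, mul_zero, sub_zero] at this
  inv_val := by
    have := geom_sum_mul_neg (-truncMonomial k [i]) k
    rwa [sub_neg_eq_add, neg_pow, truncMonomial_singleton_pow, mul_zero, sub_zero] at this

/-- The Magnus expansion `F → ℤ⟨X_1, …, X_q⟩ / J_k`, `x_i ↦ 1 + X_i`. -/
def magnus (q k : ℕ) : FreeGroup (Fin q) →* (TruncAlg q k)ˣ :=
  FreeGroup.lift (magnusUnit k)

/-!
Write `F` for the free group and `U` for the integral unitriangular matrices of size `n + 1`. With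
`c_{s,t} = ε b_{s,t}`, the equations of a defining system for `n` classes on `F/N` say that
`1 + (c_{s,t})` is multiplicative up to its corner entry, and that the Massey cochain is the
obstruction to choosing a corner entry. Since `F` is free, the obstruction disappears on `F`: every
defining system lifts to a homomorphism `Ψ : F → U` (`IsDefiningSystem.exists_isMatrixLift`), and
the pullback of the Massey cochain to `F` is minus the coboundary of the corner entry of `Ψ`
(`IsMatrixLift.masseyCochain_mk`).

Two facts about a multiplicative map into a filtered ring carry the rest. If its values lie in
`1 + A 1`, then it maps the `m`-th term `F_m` of the lower central series (`F_1 = F`) into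
`1 + A m` (`IsMulFiltration.map_sub_one_mem`), and modulo `A (m + 1)` its values on `F_m` depend
only on its linear part (`IsMulFiltration.map_sub_map_mem`). For matrices filtered by the distance
from the diagonal:

* if `N ≤ F_n`, then the corner entries of two lifts with the same superdiagonal differ by an
  `N`-invariant function, so that the Massey product has at most one element
  (`IsDefiningSystem.H2π_masseyCochain_eq`);
* if `N ≤ F_{n+1}`, then a lift is trivial on `N`, its corner entry descends to `F/N`, and the
  Massey class is zero (`IsDefiningSystem.H2π_masseyCochain_eq_zero`).

A defining system for `α_{I 0}, …, α_{I (n-1)}` comes from the Magnus expansion, followed by the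
representation of the truncated algebra that sends `X_j` to `ε` times the sum of the matrix units
`E_{i,i+1}` with `I i = j` (`magnusRep`). Its corner entry reads off `ε^n` times the coefficient of
`X_{I 0} ⋯ X_{I (n-1)}`. On `F_n` the Magnus expansion is `1` plus terms of top degree, so these
corner entries determine it (`magnus_eq_sum_corner`). Finally, if `∂z = [1] - [w]` on `F`, then the
evaluation of a coboundary on `z` is a difference of two values, and the Massey class evaluates on
the Hopf class of `w` to the corner entry of `Ψ w` (`IsMatrixLift.pairing_eq`).
-/

/-! ### Multiplicative filtrations and the lower central series -/

/-- A decreasing filtration `A 0 ⊇ A 1 ⊇ ⋯` of a ring by additive subgroups, with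
`A i * A j ⊆ A (i + j)` and `1 ∈ A 0`. The subring `A 0` need not be everything. -/
structure IsMulFiltration {R : Type*} [Ring R] (A : ℕ → AddSubgroup R) : Prop where
  antitone : Antitone A
  one_mem : 1 ∈ A 0
  mul_mem : ∀ {i j : ℕ} {a b : R}, a ∈ A i → b ∈ A j → a * b ∈ A (i + j)

namespace IsMulFiltration

open scoped commutatorElement

variable {R : Type*} [Ring R] {A : ℕ → AddSubgroup R}

theorem mem_of_le (hA : IsMulFiltration A) {i j : ℕ} (hij : i ≤ j) {a : R} (ha : a ∈ A j) :
    a ∈ A i :=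
  hA.antitone hij ha

theorem mul_mem_of_le (hA : IsMulFiltration A) {i j m : ℕ} (hm : m ≤ i + j) {a b : R}
    (ha : a ∈ A i) (hb : b ∈ A j) : a * b ∈ A m :=
  hA.mem_of_le hm (hA.mul_mem ha hb)

theorem pow_mem (hA : IsMulFiltration A) {a : R} (ha : a ∈ A 1) (m : ℕ) : a ^ m ∈ A m := by
  induction m with
  | zero => simpa using hA.one_mem
  | succ m ih => rw [pow_succ]; exact hA.mul_mem ih ha

theorem mem_zero_of_sub_one_mem (hA : IsMulFiltration A) {a : R} (ha : a - 1 ∈ A 1) : a ∈ A 0 := by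
  simpa using (A 0).add_mem (hA.mem_of_le zero_le_one ha) hA.one_mem

theorem isUnit_one_add (hA : IsMulFiltration A) {N : ℕ} (hN : A N = ⊥) {a : R} (ha : a ∈ A 1) :
    IsUnit (1 + a) := by
  refine IsNilpotent.isUnit_one_add ⟨N, ?_⟩
  simpa [hN] using hA.pow_mem ha N

/-- In a nilpotent filtration the elements of `1 + A 1` are closed under inverses: the inverse of
`1 + a` is the finite geometric series in `-a`. -/
theorem sub_one_mem_of_mul_eq_one (hA : IsMulFiltration A) {N : ℕ} (hN : A N = ⊥) {u v : R}
    (hu : u - 1 ∈ A 1) (huv : u * v = 1) (hvu : v * u = 1) : v - 1 ∈ A 1 := by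
  have hz : (-(u - 1)) ^ N = 0 := by
    simpa [hN] using hA.pow_mem ((A 1).neg_mem hu) N
  have hs : (∑ i ∈ Finset.range N, (-(u - 1)) ^ i) * u = 1 := by
    have := geom_sum_mul_neg (-(u - 1)) N
    rw [hz] at this
    simpa using this
  have hv : v = ∑ i ∈ Finset.range N, (-(u - 1)) ^ i := by
    calc v = ((∑ i ∈ Finset.range N, (-(u - 1)) ^ i) * u) * v := by rw [hs, one_mul]
      _ = _ := by rw [mul_assoc, huv, mul_one]
  have hv0 : v ∈ A 0 := by
    rw [hv]
    exact (A 0).sum_mem fun i _ =>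
      hA.mem_of_le (Nat.zero_le i) (hA.pow_mem ((A 1).neg_mem hu) i)
  have h : v - 1 = -(v * (u - 1)) := by rw [mul_sub, hvu]; simp
  rw [h]
  exact (A 1).neg_mem (hA.mul_mem_of_le (by omega) hv0 hu)

theorem map_sub_one_mem_of_of (hA : IsMulFiltration A) {N : ℕ} (hN : A N = ⊥) {α : Type*}
    (f : FreeGroup α →* R) (hf : ∀ i, f (FreeGroup.of i) - 1 ∈ A 1) (g : FreeGroup α) :
    f g - 1 ∈ A 1 := by
  have hinv : ∀ g, f g - 1 ∈ A 1 → f g⁻¹ - 1 ∈ A 1 := fun g h =>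
    hA.sub_one_mem_of_mul_eq_one hN h (by rw [← map_mul]; simp) (by rw [← map_mul]; simp)
  induction g using FreeGroup.induction_on with
  | C1 => simp [(A 1).zero_mem]
  | of i => exact hf i
  | inv_of i h => exact hinv _ h
  | mul x y hx hy =>
    have e : f (x * y) - 1 = f x * (f y - 1) + (f x - 1) := by
      rw [map_mul]; noncomm_ring
    rw [e]
    exact (A 1).add_mem (hA.mul_mem_of_le (by omega) (hA.mem_zero_of_sub_one_mem hx) hy) hx

/-- A map from a free group to `1 + A 1` that is multiplicative modulo `A n` is congruent modulo
`A n` to a multiplicative map, namely the one with the same values on the generators. -/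
theorem exists_hom_sub_mem (hA : IsMulFiltration A) {N : ℕ} (hN : A N = ⊥) {α : Type*} {n : ℕ}
    (P : FreeGroup α → R) (hP : ∀ g, P g - 1 ∈ A 1)
    (hmul : ∀ g h, P (g * h) - P g * P h ∈ A n) :
    ∃ f : FreeGroup α →* R, (∀ g, f g - 1 ∈ A 1) ∧ ∀ g, f g - P g ∈ A n := by
  have hunit : ∀ g, IsUnit (P g) := fun g => by
    simpa using hA.isUnit_one_add hN (hP g)
  let f : FreeGroup α →* R :=
    (Units.coeHom R).comp (FreeGroup.lift fun i => (hunit (FreeGroup.of i)).unit)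
  have hof : ∀ i, f (FreeGroup.of i) = P (FreeGroup.of i) := fun i => by simp [f]
  have hf : ∀ g, f g - 1 ∈ A 1 :=
    hA.map_sub_one_mem_of_of hN f fun i => by rw [hof]; exact hP _
  have hf0 : ∀ g, f g ∈ A 0 := fun g => hA.mem_zero_of_sub_one_mem (hf g)
  have hP0 : ∀ g, P g ∈ A 0 := fun g => hA.mem_zero_of_sub_one_mem (hP g)
  -- `P 1` is idempotent modulo `A n` and a unit, with an inverse in `A 0`.
  have hP1 : 1 - P 1 ∈ A n := by
    obtain ⟨u, hu⟩ := hunit 1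
    have hv : (↑u⁻¹ : R) ∈ A 0 := hA.mem_zero_of_sub_one_mem
      (hA.sub_one_mem_of_mul_eq_one hN (u := (u : R)) (by rw [hu]; exact hP 1) (by simp) (by simp))
    have e : 1 - P 1 = ↑u⁻¹ * (P (1 * 1) - P 1 * P 1) := by
      rw [mul_one, ← hu, mul_sub, ← mul_assoc]; simp
    rw [e]
    exact hA.mul_mem_of_le (by omega) hv (hmul 1 1)
  refine ⟨f, hf, fun g => ?_⟩
  induction g using FreeGroup.induction_on with
  | C1 => rw [map_one]; exact hP1
  | of i => rw [hof, sub_self]; exact (A n).zero_mem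
  | inv_of i h =>
    set x := FreeGroup.of i
    have e : f x⁻¹ - P x⁻¹ = (1 - P 1) * f x⁻¹ + (P (x⁻¹ * x) - P x⁻¹ * P x) * f x⁻¹
        - P x⁻¹ * (f x - P x) * f x⁻¹ := by
      have h1 : f x * f x⁻¹ = 1 := by rw [← map_mul]; simp
      simp only [sub_mul, mul_sub, mul_assoc, h1, inv_mul_cancel, one_mul, mul_one]
      abel
    rw [e]
    refine (A n).sub_mem ((A n).add_mem ?_ ?_) ?_
    · exact hA.mul_mem_of_le (by omega) hP1 (hf0 _)
    · exact hA.mul_mem_of_le (by omega) (hmul _ _) (hf0 _)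
    · exact hA.mul_mem_of_le (i := n) (j := 0) (by omega)
        (hA.mul_mem_of_le (by omega) (hP0 _) h) (hf0 _)
  | mul x y hx hy =>
    have e : f (x * y) - P (x * y)
        = f x * (f y - P y) + (f x - P x) * P y - (P (x * y) - P x * P y) := by
      rw [map_mul]; noncomm_ring
    rw [e]
    exact (A n).sub_mem ((A n).add_mem (hA.mul_mem_of_le (by omega) (hf0 x) hy)
      (hA.mul_mem_of_le (by omega) hx (hP0 y))) (hmul x y)

variable {Γ : Type*} [Group Γ]

theorem map_commutatorElement_sub_one (f : Γ →* R) (g h : Γ) :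
    f ⁅g, h⁆ - 1
      = ((f g - 1) * (f h - 1) - (f h - 1) * (f g - 1)) * f (g⁻¹ * h⁻¹) := by
  have e : (f g - 1) * (f h - 1) - (f h - 1) * (f g - 1) = f (g * h) - f (h * g) := by
    rw [map_mul, map_mul]; noncomm_ring
  rw [e, sub_mul, ← map_mul, ← map_mul, commutatorElement_def]
  have h1 : h * g * (g⁻¹ * h⁻¹) = 1 := by group
  rw [h1, map_one]
  simp [mul_assoc]

/-- A multiplicative map with values in `1 + A 1` maps the `n`-th term of the lower central series
(counted from `0`) to `1 + A (n + 1)`. -/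
theorem map_sub_one_mem (hA : IsMulFiltration A) (f : Γ →* R) (hf : ∀ g, f g - 1 ∈ A 1) (n : ℕ) :
    ∀ g ∈ (⊤ : Subgroup Γ).lowerCentralSeries n, f g - 1 ∈ A (n + 1) := by
  have h0 : ∀ g, f g ∈ A 0 := fun g => hA.mem_zero_of_sub_one_mem (hf g)
  induction n with
  | zero => exact fun g _ => hf g
  | succ n ih =>
    intro g hg
    rw [Subgroup.mem_lowerCentralSeries_succ_iff] at hg
    induction hg using Subgroup.closure_induction with
    | mem x hx =>
      obtain ⟨p, hp, h, -, rfl⟩ := hx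
      rw [map_commutatorElement_sub_one]
      refine hA.mul_mem_of_le (i := n + 2) (j := 0) (by omega) ((A _).sub_mem ?_ ?_) (h0 _)
      · exact hA.mul_mem_of_le (by omega) (ih p hp) (hf h)
      · exact hA.mul_mem_of_le (by omega) (hf h) (ih p hp)
    | one => simp [(A _).zero_mem]
    | mul x y _ _ hx hy =>
      have e : f (x * y) - 1 = f x * (f y - 1) + (f x - 1) := by
        rw [map_mul]; noncomm_ring
      rw [e]
      exact (A _).add_mem (hA.mul_mem_of_le (by omega) (h0 x) hy) hx
    | inv x _ hx =>
      have e : f x⁻¹ - 1 = -(f x⁻¹ * (f x - 1)) := by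
        rw [mul_sub, ← map_mul]; simp
      rw [e]
      exact (A _).neg_mem (hA.mul_mem_of_le (by omega) (h0 _) hx)

/-- Two multiplicative maps with values in `1 + A 1` that agree modulo `A 2` agree modulo
`A (n + 2)` on the `n`-th term of the lower central series: to leading order an `(n + 1)`-fold
commutator depends only on the linear parts. -/
theorem map_sub_map_mem (hA : IsMulFiltration A) (f f' : Γ →* R) (hf : ∀ g, f g - 1 ∈ A 1)
    (hf' : ∀ g, f' g - 1 ∈ A 1) (hff' : ∀ g, f g - f' g ∈ A 2) (n : ℕ) :
    ∀ g ∈ (⊤ : Subgroup Γ).lowerCentralSeries n, f g - f' g ∈ A (n + 2) := by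
  have h0 : ∀ g, f g ∈ A 0 := fun g => hA.mem_zero_of_sub_one_mem (hf g)
  have h0' : ∀ g, f' g ∈ A 0 := fun g => hA.mem_zero_of_sub_one_mem (hf' g)
  induction n with
  | zero => exact fun g _ => hff' g
  | succ n ih =>
    intro g hg
    rw [Subgroup.mem_lowerCentralSeries_succ_iff] at hg
    induction hg using Subgroup.closure_induction with
    | mem x hx =>
      obtain ⟨p, hp, h, -, rfl⟩ := hx
      have e : f ⁅p, h⁆ - f' ⁅p, h⁆
          = (((f p - f' p) * (f h - 1) + (f' p - 1) * (f h - f' h))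
              - ((f h - f' h) * (f p - 1) + (f' h - 1) * (f p - f' p))) * f (p⁻¹ * h⁻¹)
            + ((f' p - 1) * (f' h - 1) - (f' h - 1) * (f' p - 1))
              * (f (p⁻¹ * h⁻¹) - f' (p⁻¹ * h⁻¹)) := by
        rw [← sub_sub_sub_cancel_right _ _ 1, map_commutatorElement_sub_one,
          map_commutatorElement_sub_one]
        noncomm_ring
      have hp1 := hA.map_sub_one_mem f hf n p hp
      have hp1' := hA.map_sub_one_mem f' hf' n p hp
      rw [e]
      refine (A _).add_mem (hA.mul_mem_of_le (i := n + 3) (j := 0) (by omega) ?_ (h0 _))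
        (hA.mul_mem_of_le (i := n + 2) (j := 2) (by omega) ?_ (hff' _))
      · refine (A _).sub_mem ((A _).add_mem ?_ ?_) ((A _).add_mem ?_ ?_)
        · exact hA.mul_mem_of_le (by omega) (ih p hp) (hf h)
        · exact hA.mul_mem_of_le (by omega) hp1' (hff' h)
        · exact hA.mul_mem_of_le (by omega) (hff' h) hp1
        · exact hA.mul_mem_of_le (by omega) (hf' h) (ih p hp)
      · refine (A _).sub_mem ?_ ?_
        · exact hA.mul_mem_of_le (by omega) hp1' (hf' h)
        · exact hA.mul_mem_of_le (by omega) (hf' h) hp1'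
    | one => simp [(A _).zero_mem]
    | mul x y _ _ hx hy =>
      have e : f (x * y) - f' (x * y) = f x * (f y - f' y) + (f x - f' x) * f' y := by
        rw [map_mul, map_mul]; noncomm_ring
      rw [e]
      exact (A _).add_mem (hA.mul_mem_of_le (by omega) (h0 x) hy)
        (hA.mul_mem_of_le (by omega) hx (h0' y))
    | inv x _ hx =>
      have e : f x⁻¹ - f' x⁻¹ = -(f x⁻¹ * (f x - f' x) * f' x⁻¹) := by
        rw [mul_sub, sub_mul, ← map_mul, mul_assoc, ← map_mul]; simp
      rw [e]
      exact (A _).neg_mem (hA.mul_mem_of_le (i := n + 3) (j := 0) (by omega)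
        (hA.mul_mem_of_le (by omega) (h0 _) hx) (h0' _))

end IsMulFiltration

/-! ### Upper triangular matrices -/

/-- The matrices of size `n` with entries `0` at all `(s, t)` with `t < s + i`. -/
def upperFiltration (n i : ℕ) : AddSubgroup (Matrix (Fin n) (Fin n) ℤ) where
  carrier := {M | ∀ s t : Fin n, (t : ℕ) < s + i → M s t = 0}
  zero_mem' := fun _ _ _ => rfl
  add_mem' := fun ha hb s t h => by simp [ha s t h, hb s t h]
  neg_mem' := fun ha s t h => by simp [ha s t h]

theorem isMulFiltration_upperFiltration (n : ℕ) : IsMulFiltration (upperFiltration n) where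
  antitone := fun i j hij M hM s t h => hM s t (by omega)
  one_mem := fun s t h => Matrix.one_apply_ne (by rintro rfl; omega)
  mul_mem := by
    intro i j a b ha hb s t h
    rw [Matrix.mul_apply]
    refine Finset.sum_eq_zero fun r _ => ?_
    by_cases hr : (r : ℕ) < s + i
    · rw [ha s r hr, zero_mul]
    · rw [hb r t (by omega), mul_zero]

theorem upperFiltration_eq_bot {n i : ℕ} (h : n ≤ i) : upperFiltration n i = ⊥ := by
  refine (AddSubgroup.eq_bot_iff_forall _).2 fun M hM => ?_
  ext s t
  exact hM s t (by omega)

/-- The product of two unitriangular matrices, entry by entry. -/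
theorem mul_apply_of_sub_one_mem {n : ℕ} {X Y : Matrix (Fin n) (Fin n) ℤ}
    (hX : X - 1 ∈ upperFiltration n 1) (hY : Y - 1 ∈ upperFiltration n 1) {s t : Fin n}
    (hst : s < t) : (X * Y) s t = X s t + Y s t + ∑ r ∈ Finset.Ioo s t, X s r * Y r t := by
  have e : X * Y = X + Y - 1 + (X - 1) * (Y - 1) := by noncomm_ring
  have e' : ((X - 1) * (Y - 1)) s t = ∑ r ∈ Finset.Ioo s t, X s r * Y r t := by
    rw [Matrix.mul_apply, ← Finset.sum_subset (Finset.subset_univ (Finset.Ioo s t))]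
    · refine Finset.sum_congr rfl fun r hr => ?_
      rw [Finset.mem_Ioo] at hr
      simp [Matrix.one_apply_ne hr.1.ne, Matrix.one_apply_ne hr.2.ne]
    · intro r _ hr
      by_cases h : s < r
      · have h' : ¬ r < t := fun h' => hr (Finset.mem_Ioo.2 ⟨h, h'⟩)
        rw [hY r t (by omega), mul_zero]
      · rw [hX s r (by omega), zero_mul]
  rw [e, Matrix.add_apply, e', Matrix.sub_apply, Matrix.add_apply, Matrix.one_apply_ne hst.ne,
    sub_zero]

/-! ### Unitriangular representations of the truncated algebra -/

/-- The representation of `ℤ⟨X_1, …, X_q⟩` by strictly upper triangular matrices of size `n + 1`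
in which `X_j` has the entry `c` at `(i, i + 1)` whenever `I i = j`, and `0` elsewhere. The
condition is written as `L.drop s = j :: L.drop t`, with `L` the word of `I`, so that the entries
of a monomial `X_w` are described by `L.drop s = w ++ L.drop t`. -/
noncomputable def wordRep {q n : ℕ} (c : ℤ) (I : Fin n → Fin q) :
    FreeAlgebra ℤ (Fin q) →ₐ[ℤ] Matrix (Fin (n + 1)) (Fin (n + 1)) ℤ :=
  FreeAlgebra.lift ℤ fun j => Matrix.of fun s t =>
    if (List.ofFn I).drop s = j :: (List.ofFn I).drop t then c else 0

theorem wordRep_ncMonomial {q n : ℕ} (c : ℤ) (I : Fin n → Fin q) (w : List (Fin q))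
    (s t : Fin (n + 1)) :
    wordRep c I (ncMonomial w) s t
      = if (List.ofFn I).drop s = w ++ (List.ofFn I).drop t then c ^ w.length else 0 := by
  induction w generalizing s with
  | nil =>
    have h : (List.ofFn I).drop s = (List.ofFn I).drop t ↔ s = t := by
      refine ⟨fun h => ?_, fun h => by rw [h]⟩
      have := congrArg List.length h
      simp only [List.length_drop, List.length_ofFn] at this
      omega
    simp [ncMonomial, Matrix.one_apply, h]
  | cons j w ih =>
    have e : ncMonomial (j :: w) = FreeAlgebra.ι ℤ j * ncMonomial w := by simp [ncMonomial]
    have hι : ∀ u : Fin (n + 1), wordRep c I (FreeAlgebra.ι ℤ j) s u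
        = if (List.ofFn I).drop s = j :: (List.ofFn I).drop u then c else 0 := fun u => by
      simp only [wordRep, FreeAlgebra.lift_ι_apply, Matrix.of_apply]
    rw [e, map_mul, Matrix.mul_apply]
    simp only [ih, hι]
    split_ifs with h
    · have hs : (s : ℕ) < n := by
        have := congrArg List.length h
        simp at this
        omega
      have htail : (List.ofFn I).drop (s + 1) = w ++ (List.ofFn I).drop t := by
        rw [← List.tail_drop, h]; rfl
      rw [Finset.sum_eq_single (⟨s + 1, by omega⟩ : Fin (n + 1))]
      · have h1 : (List.ofFn I).drop s = j :: (List.ofFn I).drop (s + 1) := by rw [h, htail]; rfl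
        rw [if_pos h1, if_pos htail, List.length_cons, pow_succ']
      · intro u _ hu
        rw [if_neg, zero_mul]
        intro h'
        have := congrArg List.length h'
        simp only [List.length_drop, List.length_ofFn, List.length_cons] at this
        refine hu (Fin.ext ?_)
        change (u : ℕ) = s + 1
        omega
      · simp
    · refine Finset.sum_eq_zero fun u _ => ?_
      by_cases h1 : (List.ofFn I).drop s = j :: (List.ofFn I).drop u
      · rw [if_neg (c := (List.ofFn I).drop u = _), mul_zero]
        intro h2
        exact h (by rw [h1, h2]; rfl)
      · rw [if_neg h1, zero_mul]

theorem wordRep_ncMonomial_eq_zero {q n : ℕ} (c : ℤ) (I : Fin n → Fin q) {w : List (Fin q)}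
    (hw : n + 1 ≤ w.length) : wordRep c I (ncMonomial w) = 0 := by
  ext s t
  rw [wordRep_ncMonomial, if_neg, Matrix.zero_apply]
  intro h
  have := congrArg List.length h
  simp at this
  omega

theorem degIdeal_le_ker_wordRep {q n : ℕ} (c : ℤ) (I : Fin n → Fin q) :
    (degIdeal q (n + 1)).ringCon ≤ RingCon.ker (wordRep c I).toRingHom := by
  have h : degIdeal q (n + 1) ≤ TwoSidedIdeal.ker (wordRep c I).toRingHom := by
    refine TwoSidedIdeal.span_le.2 ?_
    rintro _ ⟨w, hw, rfl⟩
    exact (TwoSidedIdeal.mem_ker _).2 (wordRep_ncMonomial_eq_zero c I hw)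
  intro x y hxy
  have := (TwoSidedIdeal.mem_ker _).1 (h ((TwoSidedIdeal.rel_iff _ x y).1 hxy))
  rw [map_sub, sub_eq_zero] at this
  exact this

/-- The representation `wordRep` on the truncated algebra. -/
noncomputable def truncRep {q n : ℕ} (c : ℤ) (I : Fin n → Fin q) :
    TruncAlg q (n + 1) →+* Matrix (Fin (n + 1)) (Fin (n + 1)) ℤ :=
  (degIdeal q (n + 1)).ringCon.lift (wordRep c I).toRingHom (degIdeal_le_ker_wordRep c I)

theorem truncRep_truncMonomial {q n : ℕ} (c : ℤ) (I : Fin n → Fin q) (w : List (Fin q))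
    (s t : Fin (n + 1)) :
    truncRep c I (truncMonomial (n + 1) w) s t
      = if (List.ofFn I).drop s = w ++ (List.ofFn I).drop t then c ^ w.length else 0 :=
  wordRep_ncMonomial c I w s t

/-- The corner entry of `truncRep c I` detects the monomial of `I` among those of degree `n`. -/
theorem truncRep_truncMonomial_corner {q n : ℕ} (c : ℤ) (I J : Fin n → Fin q) :
    truncRep c I (truncMonomial (n + 1) (List.ofFn J)) 0 (Fin.last n)
      = if I = J then c ^ n else 0 := by
  have h : (List.ofFn I).drop n = [] := List.drop_of_length_le (by simp)
  rw [truncRep_truncMonomial, Fin.val_last, h]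
  simp [List.ofFn_inj]

/-! ### The degree filtration and the Magnus expansion -/

/-- The additive span of the classes of the monomials of degree `≥ i`. -/
def truncFiltration (q k i : ℕ) : AddSubgroup (TruncAlg q k) :=
  AddSubgroup.closure {p | ∃ w : List (Fin q), i ≤ w.length ∧ p = truncMonomial k w}

theorem truncMonomial_mem {q k i : ℕ} {w : List (Fin q)} (h : i ≤ w.length) :
    truncMonomial k w ∈ truncFiltration q k i :=
  AddSubgroup.subset_closure ⟨w, h, rfl⟩

theorem truncMonomial_nil (q k : ℕ) : truncMonomial k ([] : List (Fin q)) = 1 := by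
  simp [truncMonomial, ncMonomial]

theorem truncMonomial_append {q k : ℕ} (v w : List (Fin q)) :
    truncMonomial k (v ++ w) = truncMonomial k v * truncMonomial k w := by
  simp [truncMonomial, ncMonomial]

theorem truncMonomial_eq_zero {q k : ℕ} {w : List (Fin q)} (h : k ≤ w.length) :
    truncMonomial k w = 0 := by
  have hw : ncMonomial w ∈ degIdeal q k := TwoSidedIdeal.subset_span ⟨w, h, rfl⟩
  rw [truncMonomial, ← map_zero (degIdeal q k).ringCon.mk']
  exact Quotient.sound' ((degIdeal q k).rel_iff _ _ |>.2 (by simpa using hw))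

theorem isMulFiltration_truncFiltration (q k : ℕ) : IsMulFiltration (truncFiltration q k) where
  antitone := by
    intro i j hij
    refine AddSubgroup.closure_mono ?_
    rintro _ ⟨w, hw, rfl⟩
    exact ⟨w, hij.trans hw, rfl⟩
  one_mem := by
    rw [← truncMonomial_nil]
    exact truncMonomial_mem (Nat.zero_le _)
  mul_mem := by
    intro i j a b ha hb
    induction ha using AddSubgroup.closure_induction with
    | mem x hx =>
      obtain ⟨v, hv, rfl⟩ := hx
      induction hb using AddSubgroup.closure_induction with
      | mem y hy =>
        obtain ⟨w, hw, rfl⟩ := hy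
        rw [← truncMonomial_append]
        exact truncMonomial_mem (by rw [List.length_append]; omega)
      | zero => rw [mul_zero]; exact zero_mem _
      | add x y _ _ hx hy => rw [mul_add]; exact add_mem hx hy
      | neg x _ hx => rw [mul_neg]; exact neg_mem hx
    | zero => rw [zero_mul]; exact zero_mem _
    | add x y _ _ hx hy => rw [add_mul]; exact add_mem hx hy
    | neg x _ hx => rw [neg_mul]; exact neg_mem hx

theorem truncFiltration_eq_bot (q k : ℕ) : truncFiltration q k k = ⊥ := by
  refine AddSubgroup.closure_eq_bot_iff.2 ?_
  rintro _ ⟨w, hw, rfl⟩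
  exact truncMonomial_eq_zero hw

/-- The Magnus expansion as a multiplicative map into the truncated algebra. -/
noncomputable def magnusHom (q k : ℕ) : FreeGroup (Fin q) →* TruncAlg q k :=
  (Units.coeHom _).comp (magnus q k)

theorem magnusHom_of {q k : ℕ} (i : Fin q) :
    magnusHom q k (FreeGroup.of i) = 1 + truncMonomial k [i] := by
  simp [magnusHom, magnus, magnusUnit]

theorem magnusHom_sub_one_mem {q k : ℕ} (g : FreeGroup (Fin q)) :
    magnusHom q k g - 1 ∈ truncFiltration q k 1 := by
  refine (isMulFiltration_truncFiltration q k).map_sub_one_mem_of_of (truncFiltration_eq_bot q k)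
    _ (fun i => ?_) g
  rw [magnusHom_of, add_sub_cancel_left]
  exact truncMonomial_mem le_rfl

/-- An element of the top degree part of the truncated algebra is recovered from the corner entries
of the representations `truncRep c I`, for `c = ±1`. -/
theorem eq_sum_corner_of_mem {q n : ℕ} (ε : ℤˣ) {a : TruncAlg q (n + 1)}
    (ha : a ∈ truncFiltration q (n + 1) n) :
    a = ∑ I : Fin n → Fin q, ((ε : ℤ) ^ n * truncRep (ε : ℤ) I a 0 (Fin.last n))
      • truncMonomial (n + 1) (List.ofFn I) := by
  induction ha using AddSubgroup.closure_induction with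
  | mem x hx =>
    obtain ⟨w, hw, rfl⟩ := hx
    rcases hw.eq_or_lt with hw | hw
    · obtain ⟨J, rfl⟩ : ∃ J : Fin n → Fin q, w = List.ofFn J := by
        subst hw
        exact ⟨w.get, by simp⟩
      have hε : (ε : ℤ) ^ n * (ε : ℤ) ^ n = 1 := by
        rw [← mul_pow, ← Units.val_mul, Int.units_mul_self]; simp
      rw [Finset.sum_eq_single J]
      · rw [truncRep_truncMonomial_corner, if_pos rfl, hε, one_smul]
      · intro I _ hI
        rw [truncRep_truncMonomial_corner, if_neg hI, mul_zero, zero_smul]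
      · simp
    · simp [truncMonomial_eq_zero (show n + 1 ≤ w.length from hw)]
  | zero => simp
  | add x y _ _ hx hy =>
    nth_rewrite 1 [hx, hy]
    rw [← Finset.sum_add_distrib]
    refine Finset.sum_congr rfl fun I _ => ?_
    rw [map_add, Matrix.add_apply, mul_add, add_smul]
  | neg x _ hx =>
    nth_rewrite 1 [hx]
    rw [← Finset.sum_neg_distrib]
    refine Finset.sum_congr rfl fun I _ => ?_
    rw [map_neg, Matrix.neg_apply, mul_neg, neg_smul]

/-- The unitriangular representation of the free group that corresponds to the word `I`: it maps
`x_j` to `1 + c ∑ E_{i,i+1}`, the sum over the `i` with `I i = j`. It factors through the Magnus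
expansion. -/
noncomputable def magnusRep {q n : ℕ} (c : ℤ) (I : Fin n → Fin q) :
    FreeGroup (Fin q) →* Matrix (Fin (n + 1)) (Fin (n + 1)) ℤ :=
  (truncRep c I : TruncAlg q (n + 1) →* _).comp (magnusHom q (n + 1))

theorem magnusRep_of {q n : ℕ} (c : ℤ) (I : Fin n → Fin q) (j : Fin q) :
    magnusRep c I (FreeGroup.of j) = 1 + truncRep c I (truncMonomial (n + 1) [j]) := by
  simp [magnusRep, magnusHom_of]

theorem magnusRep_sub_one_mem {q n : ℕ} (c : ℤ) (I : Fin n → Fin q) (g : FreeGroup (Fin q)) :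
    magnusRep c I g - 1 ∈ upperFiltration (n + 1) 1 := by
  refine (isMulFiltration_upperFiltration _).map_sub_one_mem_of_of (upperFiltration_eq_bot le_rfl)
    _ (fun j s t hst => ?_) g
  rw [magnusRep_of, add_sub_cancel_left, truncRep_truncMonomial, if_neg]
  intro h
  have := congrArg List.length h
  simp at this
  omega

theorem magnusRep_of_castSucc_succ {q n : ℕ} (c : ℤ) (I : Fin n → Fin q) (j : Fin q) (i : Fin n) :
    magnusRep c I (FreeGroup.of j) i.castSucc i.succ = if j = I i then c else 0 := by
  have h : (List.ofFn I).drop i = I i :: (List.ofFn I).drop (i + 1) := by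
    rw [List.drop_eq_getElem_cons (by simp)]
    simp
  rw [magnusRep_of, Matrix.add_apply, Matrix.one_apply_ne i.castSucc_lt_succ.ne, zero_add,
    truncRep_truncMonomial]
  simp [h, eq_comm]

/-- The top degree coefficients of the Magnus expansion of an element of the lower central series
are the corner entries of the representations `magnusRep`. -/
theorem magnus_eq_sum_corner {q n : ℕ} (hn : 1 ≤ n) (ε : ℤˣ) {w : FreeGroup (Fin q)}
    (hw : w ∈ lcs q n) :
    (magnus q (n + 1) w : TruncAlg q (n + 1))
      = 1 + ∑ I : Fin n → Fin q, ((ε : ℤ) ^ n * magnusRep (ε : ℤ) I w 0 (Fin.last n))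
        • truncMonomial (n + 1) (List.ofFn I) := by
  have hmem : magnusHom q (n + 1) w - 1 ∈ truncFiltration q (n + 1) n := by
    have := (isMulFiltration_truncFiltration q (n + 1)).map_sub_one_mem (magnusHom q (n + 1))
      magnusHom_sub_one_mem (n - 1) w hw
    rwa [Nat.sub_add_cancel hn] at this
  have hne : (0 : Fin (n + 1)) ≠ Fin.last n := by
    intro h
    have := congrArg Fin.val h
    simp at this
    omega
  have h := eq_sum_corner_of_mem ε hmem
  rw [sub_eq_iff_eq_add'] at h
  refine h.trans ?_
  congr 1
  refine Finset.sum_congr rfl fun I _ => ?_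
  rw [map_sub, map_one, Matrix.sub_apply, Matrix.one_apply_ne hne, sub_zero]
  rfl

/-! ### Defining systems as unitriangular representations -/

theorem Int.units_mul_self_mul (ε : ℤˣ) (a : ℤ) : (ε : ℤ) * (ε * a) = a := by
  rw [← mul_assoc, ← Units.val_mul, Int.units_mul_self, Units.val_one, one_mul]

theorem Fin.zero_ne_last_of_pos {n : ℕ} (hn : 0 < n) : (0 : Fin (n + 1)) ≠ Fin.last n := by
  intro h
  have := congrArg Fin.val h
  simp at this
  omega

/-- Membership in `upperFiltration (n + 1) n` means that all entries but the corner vanish. -/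
theorem lt_add_iff_ne_corner {n : ℕ} (s t : Fin (n + 1)) :
    (t : ℕ) < s + n ↔ (s, t) ≠ (0, Fin.last n) := by
  rw [Ne, Prod.mk_inj, Fin.ext_iff, Fin.ext_iff, Fin.val_zero, Fin.val_last]
  omega

/-- A unitriangular representation `Ψ` of the free group lifts the family `b` of cochains of `F/N`
if its entries `(s, t)` with `s < t`, apart from the corner, are the pullbacks of `ε b s t`. The
equations of a defining system say that the `ε b s t` are multiplicative modulo the corner. -/
structure IsMatrixLift {q n : ℕ} (N : Subgroup (FreeGroup (Fin q))) [N.Normal] (ε : ℤˣ)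
    (b : Fin (n + 1) → Fin (n + 1) → FreeGroup (Fin q) ⧸ N → ℤ)
    (Ψ : FreeGroup (Fin q) →* Matrix (Fin (n + 1)) (Fin (n + 1)) ℤ) : Prop where
  unitriangular : ∀ g, Ψ g - 1 ∈ upperFiltration (n + 1) 1
  entry : ∀ g (s t : Fin (n + 1)), s < t → (s, t) ≠ (0, Fin.last n) → Ψ g s t = ε * b s t g

section

variable {q n : ℕ} {N : Subgroup (FreeGroup (Fin q))} [N.Normal] {ε : ℤˣ}
  {γ : Fin n → groupCohomology.cocycles₁ (trivZ (FreeGroup (Fin q) ⧸ N))}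
  {b b' : Fin (n + 1) → Fin (n + 1) → FreeGroup (Fin q) ⧸ N → ℤ}
  {Ψ Ψ' : FreeGroup (Fin q) →* Matrix (Fin (n + 1)) (Fin (n + 1)) ℤ}

theorem IsDefiningSystem.apply_mul {G : Type} [Group G]
    {γ : Fin n → groupCohomology.cocycles₁ (trivZ G)} {b : Fin (n + 1) → Fin (n + 1) → G → ℤ}
    (hb : IsDefiningSystem ε γ b) {s t : Fin (n + 1)} (hst : s < t)
    (hne : (s, t) ≠ (0, Fin.last n)) (x y : G) :
    b s t (x * y) = b s t x + b s t y + ε * ∑ r ∈ Finset.Ioo s t, b s r x * b r t y := by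
  have := congrFun (hb.cobound_eq s t hst hne) (x, y)
  simp only [cobound, cup, Pi.smul_apply, Finset.sum_apply, smul_eq_mul,
    Finset.sum_neg_distrib] at this
  linarith

/-- Every defining system on `F/N` lifts to a representation of the free group `F`: the corner
entries can be chosen freely on the generators. -/
theorem IsDefiningSystem.exists_isMatrixLift (hb : IsDefiningSystem ε γ b) :
    ∃ Ψ, IsMatrixLift N ε b Ψ := by
  let P : FreeGroup (Fin q) → Matrix (Fin (n + 1)) (Fin (n + 1)) ℤ := fun g =>
    Matrix.of fun s t => if s < t then ε * b s t g else if s = t then 1 else 0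
  have hlt : ∀ g s t, s < t → P g s t = ε * b s t g := fun g s t h => by simp [P, h]
  have hP : ∀ g, P g - 1 ∈ upperFiltration (n + 1) 1 := by
    intro g s t h
    have h1 : ¬ s < t := by omega
    by_cases h2 : s = t
    · simp [P, h2]
    · simp [P, h1, h2]
  have hmul : ∀ g h, P (g * h) - P g * P h ∈ upperFiltration (n + 1) n := by
    intro x y s t h
    rw [lt_add_iff_ne_corner] at h
    rw [Matrix.sub_apply, sub_eq_zero]
    by_cases hst : s < t
    · rw [mul_apply_of_sub_one_mem (hP x) (hP y) hst, hlt _ _ _ hst, hlt _ _ _ hst, hlt _ _ _ hst,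
        QuotientGroup.mk_mul, hb.apply_mul hst h, mul_add, mul_add, Int.units_mul_self_mul]
      congr 1
      refine Finset.sum_congr rfl fun r hr => ?_
      rw [Finset.mem_Ioo] at hr
      rw [hlt _ _ _ hr.1, hlt _ _ _ hr.2, mul_mul_mul_comm, mul_assoc,
        Int.units_mul_self_mul]
    · have hU := isMulFiltration_upperFiltration (n + 1)
      have h1 : P (x * y) - P x * P y ∈ upperFiltration (n + 1) 1 := by
        have e : P (x * y) - P x * P y
            = (P (x * y) - 1) - (P x - 1) - P x * (P y - 1) := by noncomm_ring
        rw [e]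
        exact sub_mem (sub_mem (hP _) (hP _))
          (hU.mul_mem_of_le (by omega) (hU.mem_zero_of_sub_one_mem (hP x)) (hP y))
      exact sub_eq_zero.1 (h1 s t (by omega))
  obtain ⟨Ψ, hΨ, hΨP⟩ := (isMulFiltration_upperFiltration (n + 1)).exists_hom_sub_mem
    (upperFiltration_eq_bot le_rfl) P hP hmul
  refine ⟨Ψ, hΨ, fun g s t hst hne => ?_⟩
  rw [← hlt g s t hst]
  exact sub_eq_zero.1 (hΨP g s t ((lt_add_iff_ne_corner s t).2 hne))

/-- A representation of the free group that maps `N` into the corner subgroup gives a defining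
system on `F/N`. -/
theorem exists_isDefiningSystem (hΨ : ∀ g, Ψ g - 1 ∈ upperFiltration (n + 1) 1)
    (hN : ∀ w ∈ N, Ψ w - 1 ∈ upperFiltration (n + 1) n)
    (hγ : ∀ g (i : Fin n), Ψ g i.castSucc i.succ
      = ε * (γ i : FreeGroup (Fin q) ⧸ N → ℤ) (g : FreeGroup (Fin q) ⧸ N)) :
    ∃ b, IsDefiningSystem ε γ b ∧ IsMatrixLift N ε b Ψ := by
  have hU := isMulFiltration_upperFiltration (n + 1)
  let b : Fin (n + 1) → Fin (n + 1) → FreeGroup (Fin q) ⧸ N → ℤ :=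
    fun s t g => ε * Ψ g.out s t
  have hentry : ∀ (g : FreeGroup (Fin q)) (s t : Fin (n + 1)), (s, t) ≠ (0, Fin.last n) →
      b s t (g : FreeGroup (Fin q) ⧸ N) = ε * Ψ g s t := by
    intro g s t hne
    obtain ⟨w, hw⟩ := QuotientGroup.mk_out_eq_mul N g
    have h : Ψ (g * w) - Ψ g ∈ upperFiltration (n + 1) n := by
      have e : Ψ (g * w) - Ψ g = Ψ g * (Ψ w - 1) := by rw [map_mul]; noncomm_ring
      rw [e]
      exact hU.mul_mem_of_le (by omega) (hU.mem_zero_of_sub_one_mem (hΨ g)) (hN w w.2)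
    have h' := sub_eq_zero.1 (h s t ((lt_add_iff_ne_corner s t).2 hne))
    change (ε : ℤ) * Ψ (g : FreeGroup (Fin q) ⧸ N).out s t = _
    rw [hw, h']
  refine ⟨b, ⟨fun i => ?_, fun s t hst hne => ?_⟩, hΨ, fun g s t _ hne => ?_⟩
  · funext g
    change (ε : ℤ) * Ψ g.out i.castSucc i.succ = _
    rw [hγ, Int.units_mul_self_mul, QuotientGroup.out_eq']
  · funext ⟨x, y⟩
    induction x using QuotientGroup.induction_on with | H x
    induction y using QuotientGroup.induction_on with | H y
    simp only [cobound, cup, Pi.smul_apply, Finset.sum_apply, smul_eq_mul]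
    rw [← QuotientGroup.mk_mul, hentry _ _ _ hne, hentry _ _ _ hne, hentry _ _ _ hne, map_mul,
      mul_apply_of_sub_one_mem (hΨ x) (hΨ y) hst, Finset.sum_neg_distrib]
    have hsum : ∑ r ∈ Finset.Ioo s t, b s r x * b r t y
        = ∑ r ∈ Finset.Ioo s t, Ψ x s r * Ψ y r t := by
      refine Finset.sum_congr rfl fun r hr => ?_
      rw [Finset.mem_Ioo] at hr
      have h1 : (s, r) ≠ (0, Fin.last n) := by
        intro h
        rw [Prod.mk_inj] at h
        exact (hr.2.trans_le (Fin.le_last t)).ne h.2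
      have h2 : (r, t) ≠ (0, Fin.last n) := by
        intro h
        rw [Prod.mk_inj] at h
        exact ((Fin.zero_le s).trans_lt hr.1).ne' h.1
      rw [hentry _ _ _ h1, hentry _ _ _ h2, mul_mul_mul_comm, mul_assoc, Int.units_mul_self_mul]
    rw [hsum]
    ring
  · rw [hentry _ _ _ hne, Int.units_mul_self_mul]

/-- On the free group, the Massey cochain is minus the coboundary of the corner entry of a lift. -/
theorem IsMatrixLift.masseyCochain_mk (h : IsMatrixLift N ε b Ψ) (hn : 0 < n)
    (x y : FreeGroup (Fin q)) :
    masseyCochain b ((x : FreeGroup (Fin q) ⧸ N), (y : FreeGroup (Fin q) ⧸ N))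
      = -cobound (fun g => Ψ g 0 (Fin.last n)) (x, y) := by
  have hlt : (0 : Fin (n + 1)) < Fin.last n :=
    lt_of_le_of_ne (Fin.zero_le _) (Fin.zero_ne_last_of_pos hn)
  have hsum : ∑ r ∈ Finset.Ioo 0 (Fin.last n), Ψ x 0 r * Ψ y r (Fin.last n)
      = ∑ r ∈ Finset.Ioo 0 (Fin.last n), b 0 r x * b r (Fin.last n) y := by
    refine Finset.sum_congr rfl fun r hr => ?_
    rw [Finset.mem_Ioo] at hr
    rw [h.entry _ _ _ hr.1 (by simp [hr.2.ne]), h.entry _ _ _ hr.2 (by simp [hr.1.ne']),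
      mul_mul_mul_comm, mul_assoc, Int.units_mul_self_mul]
  simp only [masseyCochain, cobound, cup, Pi.neg_apply, Finset.sum_apply, Finset.sum_neg_distrib,
    neg_neg]
  rw [map_mul, mul_apply_of_sub_one_mem (h.unitriangular x) (h.unitriangular y) hlt, hsum]
  ring

/-- Two cocycles on `F/N` are cohomologous if their difference, pulled back to `F`, is the
coboundary of an `N`-invariant cochain. -/
theorem H2π_eq_of_cobound_invariant
    (f f' : groupCohomology.cocycles₂ (trivZ (FreeGroup (Fin q) ⧸ N))) (e : FreeGroup (Fin q) → ℤ)
    (he : ∀ x, ∀ w ∈ N, e (x * w) = e x)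
    (hf : ∀ x y : FreeGroup (Fin q),
      (f.1 : (FreeGroup (Fin q) ⧸ N) × (FreeGroup (Fin q) ⧸ N) → ℤ) (x, y)
        - (f'.1 : (FreeGroup (Fin q) ⧸ N) × (FreeGroup (Fin q) ⧸ N) → ℤ) (x, y)
        = cobound e (x, y)) :
    groupCohomology.H2π (trivZ (FreeGroup (Fin q) ⧸ N)) f
      = groupCohomology.H2π (trivZ (FreeGroup (Fin q) ⧸ N)) f' := by
  rw [groupCohomology.H2π_eq_iff]
  have hout : ∀ x : FreeGroup (Fin q), e (x : FreeGroup (Fin q) ⧸ N).out = e x := by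
    intro x
    obtain ⟨w, hw⟩ := QuotientGroup.mk_out_eq_mul N x
    rw [hw, he x w w.2]
  refine ⟨fun g => e g.out, ?_⟩
  change cobound (fun g : FreeGroup (Fin q) ⧸ N => e g.out) = _
  funext ⟨x, y⟩
  induction x using QuotientGroup.induction_on with | H x
  induction y using QuotientGroup.induction_on with | H y
  refine Eq.trans ?_ (hf x y).symm
  simp only [cobound]
  rw [← QuotientGroup.mk_mul, hout, hout, hout]

/-- For `N ≤ F_n`, all defining systems on `F/N` for the same `n` classes have the same Massey
class: the difference of the corner entries of two lifts is `N`-invariant. -/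
theorem IsDefiningSystem.H2π_masseyCochain_eq (hn : 2 ≤ n) (hN : N ≤ lcs q n)
    (hb : IsDefiningSystem ε γ b) (hb' : IsDefiningSystem ε γ b') :
    groupCohomology.H2π (trivZ (FreeGroup (Fin q) ⧸ N)) ⟨masseyCochain b, hb.masseyCochain_mem⟩
      = groupCohomology.H2π (trivZ (FreeGroup (Fin q) ⧸ N))
        ⟨masseyCochain b', hb'.masseyCochain_mem⟩ := by
  obtain ⟨Ψ, h⟩ := hb.exists_isMatrixLift
  obtain ⟨Ψ', h'⟩ := hb'.exists_isMatrixLift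
  have hU := isMulFiltration_upperFiltration (n + 1)
  have h2 : ∀ g, Ψ g - Ψ' g ∈ upperFiltration (n + 1) 2 := by
    intro g s t hst
    by_cases h1 : (t : ℕ) < s + 1
    · have := (sub_mem (h.unitriangular g) (h'.unitriangular g)) s t h1
      simpa using this
    · have hs : (s : ℕ) < n := by omega
      obtain ⟨i, rfl⟩ : ∃ i : Fin n, s = i.castSucc := ⟨⟨s, hs⟩, rfl⟩
      obtain rfl : t = i.succ := by
        ext
        simp only [Fin.val_castSucc, Fin.val_succ] at *
        omega
      have hne : (i.castSucc, i.succ) ≠ (0, Fin.last n) := by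
        rw [← lt_add_iff_ne_corner]
        simp only [Fin.val_castSucc, Fin.val_succ]
        omega
      rw [Matrix.sub_apply, h.entry _ _ _ i.castSucc_lt_succ hne,
        h'.entry _ _ _ i.castSucc_lt_succ hne, hb.diag, hb'.diag, sub_self]
  have hdiff : ∀ w ∈ N, Ψ w = Ψ' w := by
    intro w hw
    have := hU.map_sub_map_mem Ψ Ψ' h.unitriangular h'.unitriangular h2 (n - 1) w (hN hw)
    rwa [upperFiltration_eq_bot (by omega), AddSubgroup.mem_bot, sub_eq_zero] at this
  have hinv : ∀ x, ∀ w ∈ N, Ψ' (x * w) - Ψ (x * w) = Ψ' x - Ψ x := by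
    intro x w hw
    have hw1 := hU.map_sub_one_mem Ψ' h'.unitriangular (n - 1) w (hN hw)
    -- `Ψ' w = Ψ w` differs from `1` only in the corner, which `Ψ' x - Ψ x ∈ A 2` annihilates.
    have h0 : (Ψ' x - Ψ x) * (Ψ' w - 1) ∈ upperFiltration (n + 1) (n + 1) :=
      hU.mul_mem_of_le (i := 2) (j := n - 1 + 1) (by omega)
        (by rw [← neg_sub]; exact neg_mem (h2 x)) hw1
    rw [upperFiltration_eq_bot le_rfl, AddSubgroup.mem_bot, mul_sub, mul_one, sub_eq_zero] at h0
    rw [map_mul, map_mul, hdiff w hw, ← sub_mul, h0]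
  refine H2π_eq_of_cobound_invariant _ _
    (fun g => (Ψ' g - Ψ g) 0 (Fin.last n)) (fun x w hw => by rw [hinv x w hw]) fun x y => ?_
  change masseyCochain b _ - masseyCochain b' _ = _
  rw [h.masseyCochain_mk (by omega), h'.masseyCochain_mk (by omega)]
  simp only [cobound, Matrix.sub_apply]
  ring

/-- The Massey class vanishes if the system has a lift that is trivial on `N`. -/
theorem IsDefiningSystem.H2π_masseyCochain_eq_zero (hn : 0 < n) (hb : IsDefiningSystem ε γ b)
    (h : IsMatrixLift N ε b Ψ) (hN : ∀ w ∈ N, Ψ w = 1) :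
    groupCohomology.H2π (trivZ (FreeGroup (Fin q) ⧸ N)) ⟨masseyCochain b, hb.masseyCochain_mem⟩
      = 0 := by
  rw [← map_zero (groupCohomology.H2π (trivZ (FreeGroup (Fin q) ⧸ N))).hom]
  refine H2π_eq_of_cobound_invariant _ _ (fun g => (-Ψ g) 0 (Fin.last n))
    (fun x w hw => by rw [map_mul, hN w hw, mul_one]) fun x y => ?_
  change masseyCochain b _ - 0 = _
  rw [h.masseyCochain_mk hn]
  simp only [cobound, Matrix.neg_apply]
  ring

end

/-! ### The Massey products of the classes `α_j` -/

theorem magnusRep_castSucc_succ {q n : ℕ} (ε : ℤˣ) (I : Fin n → Fin q) (g : FreeGroup (Fin q))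
    (i : Fin n) :
    magnusRep (ε : ℤ) I g i.castSucc i.succ = ε * (expSum (I i) g).toAdd := by
  let e : FreeGroup (Fin q) →* Multiplicative ℤ := MonoidHom.mk'
    (fun g => Multiplicative.ofAdd ((ε : ℤ) * magnusRep (ε : ℤ) I g i.castSucc i.succ)) (by
      intro x y
      have h0 : Finset.Ioo i.castSucc i.succ = ∅ := by
        ext r
        simp only [Finset.mem_Ioo, Fin.lt_def, Fin.val_castSucc, Fin.val_succ, Finset.notMem_empty,
          iff_false]
        omega
      rw [← ofAdd_add, ← mul_add, map_mul (magnusRep (ε : ℤ) I),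
        mul_apply_of_sub_one_mem (magnusRep_sub_one_mem _ I x)
        (magnusRep_sub_one_mem _ I y) i.castSucc_lt_succ, h0, Finset.sum_empty, add_zero])
  have he : e = expSum (I i) := by
    refine FreeGroup.ext_hom _ _ fun j => ?_
    change Multiplicative.ofAdd _ = _
    rw [magnusRep_of_castSucc_succ, expSum, FreeGroup.lift_apply_of]
    congr 1
    split_ifs
    · rw [← Units.val_mul, Int.units_mul_self, Units.val_one]
    · simp
  rw [← he]
  exact (Int.units_mul_self_mul ε _).symm

/-- For `N ≤ F_n`, the Massey product of `α_{I 0}, …, α_{I (n-1)}` on `F/N` is the single class of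
the defining system that the coefficients of the Magnus expansion provide. -/
theorem exists_masseyProduct_alpha_eq {q n : ℕ} (hn : 2 ≤ n) (N : Subgroup (FreeGroup (Fin q)))
    [N.Normal] (hN : N ≤ commutator (FreeGroup (Fin q))) (hNn : N ≤ lcs q n) (ε : ℤˣ)
    (I : Fin n → Fin q) :
    ∃ (b : _) (hb : IsDefiningSystem ε (fun i => alpha N hN (I i)) b),
      IsMatrixLift N ε b (magnusRep (ε : ℤ) I) ∧
      masseyProduct ε (fun i => alpha N hN (I i))
        = {groupCohomology.H2π (trivZ (FreeGroup (Fin q) ⧸ N))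
            ⟨masseyCochain b, hb.masseyCochain_mem⟩} := by
  obtain ⟨b, hb, hlift⟩ := exists_isDefiningSystem (N := N) (ε := ε)
    (γ := fun i => alpha N hN (I i)) (magnusRep_sub_one_mem (ε : ℤ) I)
    (fun w hw => by
      have := (isMulFiltration_upperFiltration (n + 1)).map_sub_one_mem _
        (magnusRep_sub_one_mem (ε : ℤ) I) (n - 1) w (hNn hw)
      rwa [Nat.sub_add_cancel (by omega)] at this)
    (fun g i => magnusRep_castSucc_succ ε I g i)
  refine ⟨b, hb, hlift, Set.eq_singleton_iff_unique_mem.2 ⟨⟨b, hb, rfl⟩, ?_⟩⟩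
  rintro _ ⟨b', hb', rfl⟩
  exact hb'.H2π_masseyCochain_eq hn hNn hb

/-- For `N ≤ F_{n+1}` the corner entry descends to `F/N` as well. -/
theorem masseyProduct_alpha_eq_zero {q n : ℕ} (hn : 2 ≤ n) (N : Subgroup (FreeGroup (Fin q)))
    [N.Normal] (hN : N ≤ commutator (FreeGroup (Fin q))) (hNn : N ≤ lcs q (n + 1)) (ε : ℤˣ)
    (I : Fin n → Fin q) :
    masseyProduct ε (fun i => alpha N hN (I i)) = {0} := by
  obtain ⟨b, hb, hlift, h⟩ := exists_masseyProduct_alpha_eq hn N hN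
    (hNn.trans (Subgroup.lowerCentralSeries_antitone _ (by omega))) ε I
  rw [h, hb.H2π_masseyCochain_eq_zero (by omega) hlift fun w hw => ?_]
  have := (isMulFiltration_upperFiltration (n + 1)).map_sub_one_mem _
    (magnusRep_sub_one_mem (ε : ℤ) I) n w (hNn hw)
  rwa [upperFiltration_eq_bot le_rfl, AddSubgroup.mem_bot, sub_eq_zero] at this

/-! ### Evaluation on Hopf classes -/

theorem evalChain_mapDomain {G H : Type} (p : G → H) (f : H × H → ℤ) (z : G × G →₀ ℤ) :
    evalChain f (z.mapDomain (Prod.map p p)) = evalChain (fun g => f (p g.1, p g.2)) z :=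
  Finsupp.sum_mapDomain_index (by simp) (by intros; ring)

/-- The value of the Massey class on the Hopf class of `w` is the corner entry of a lift at `w`. -/
theorem IsMatrixLift.pairing_eq {q n : ℕ} (hn : 0 < n) {N : Subgroup (FreeGroup (Fin q))}
    [N.Normal] {ε : ℤˣ} {γ : Fin n → groupCohomology.cocycles₁ (trivZ (FreeGroup (Fin q) ⧸ N))}
    {b : Fin (n + 1) → Fin (n + 1) → FreeGroup (Fin q) ⧸ N → ℤ}
    {Ψ : FreeGroup (Fin q) →* Matrix (Fin (n + 1)) (Fin (n + 1)) ℤ}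
    (hΨ : IsMatrixLift N ε b Ψ) (hb : IsDefiningSystem ε γ b) {w : FreeGroup (Fin q)}
    {h : groupHomology.H2 (trivZ (FreeGroup (Fin q) ⧸ N))} (hw : IsHopfClass N w h) :
    pairing (groupCohomology.H2π (trivZ (FreeGroup (Fin q) ⧸ N))
      ⟨masseyCochain b, hb.masseyCochain_mem⟩) h = Ψ w 0 (Fin.last n) := by
  obtain ⟨z, c, hz, hc, rfl⟩ := hw
  rw [pairing_mk, hc]
  refine (evalChain_mapDomain (QuotientGroup.mk' N) (masseyCochain b) z).trans ?_
  have e : (fun g : FreeGroup (Fin q) × FreeGroup (Fin q) =>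
      masseyCochain b (QuotientGroup.mk' N g.1, QuotientGroup.mk' N g.2))
      = cobound (fun g => -Ψ g 0 (Fin.last n)) := by
    funext g
    refine (hΨ.masseyCochain_mk hn g.1 g.2).trans ?_
    simp only [cobound]
    ring
  rw [e, evalChain_cobound, hz, Finsupp.sum_sub_index (by intros; ring)]
  simp [Matrix.one_apply_ne (Fin.zero_ne_last_of_pos hn)]

/-- Hopf classes are natural with respect to the projections `F/N → F/N'`. -/
theorem IsHopfClass.pushH2 {q : ℕ} {N N' : Subgroup (FreeGroup (Fin q))} [N.Normal] [N'.Normal]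
    (hNN' : N ≤ N') {w : FreeGroup (Fin q)}
    {h : groupHomology.H2 (trivZ (FreeGroup (Fin q) ⧸ N))} (hw : IsHopfClass N w h) :
    IsHopfClass N' w (pushH2 (quotProj N N' hNN') h) := by
  obtain ⟨z, c, hz, hc, rfl⟩ := hw
  let φ : trivZ (FreeGroup (Fin q) ⧸ N) ⟶
      Rep.res (quotProj N N' hNN') (trivZ (FreeGroup (Fin q) ⧸ N')) :=
    Rep.ofHom ⟨LinearMap.id, fun _ => rfl⟩
  refine ⟨z, groupHomology.mapCycles₂ (quotProj N N' hNN') φ c, hz, ?_, ?_⟩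
  · have hchain : ∀ v : (FreeGroup (Fin q) ⧸ N) × (FreeGroup (Fin q) ⧸ N) →₀ ℤ,
        (groupHomology.chainsMap₂ (quotProj N N' hNN') φ).hom v
          = v.mapDomain (Prod.map (quotProj N N' hNN') (quotProj N N' hNN')) :=
      fun v => Finsupp.ext fun _ => rfl
    rw [groupHomology.coe_mapCycles₂, hc]
    refine (hchain _).trans ?_
    rw [← Finsupp.mapDomain_comp]
    rfl
  · exact (congr($(groupHomology.H2π_comp_map (quotProj N N' hNN') φ) c)).symm

theorem theorem4p1 {q t k : ℕ} (hk : 3 ≤ k) (W : Fin t → FreeGroup (Fin q))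
    (hW : ∀ j, W j ∈ lcs q k) (ε : ℤˣ) :
    (∀ ℓ : ℕ, 2 ≤ ℓ → ℓ < k → ∀ I : Fin ℓ → Fin q,
      masseyProduct ε
        (fun i => alpha (relSubgroup k W) (relSubgroup_le_commutator hk hW) (I i)) = {0}) ∧
    ∃ (m : (Fin k → Fin q) → groupCohomology.H2 (trivZ (FreeGroup (Fin q) ⧸ relSubgroup k W)))
      (m' : (Fin k → Fin q) → groupCohomology.H2 (trivZ (FreeGroup (Fin q) ⧸ lcs q k))),
      (∀ I, masseyProduct ε
        (fun i => alpha (relSubgroup k W) (relSubgroup_le_commutator hk hW) (I i)) = {m I}) ∧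
      (∀ I, masseyProduct ε
        (fun i => alpha (lcs q k) (lcs_le_commutator (le_of_lt hk)) (I i)) = {m' I}) ∧
      ∀ (j : Fin t) (h : groupHomology.H2 (trivZ (FreeGroup (Fin q) ⧸ relSubgroup k W))),
        IsHopfClass (relSubgroup k W) (W j) h →
        (magnus q (k + 1) (W j) : TruncAlg q (k + 1))
            = 1 + ∑ I : Fin k → Fin q,
              ((ε : ℤ) ^ k * pairing (m I) h) • truncMonomial (k + 1) (List.ofFn I) ∧
        (magnus q (k + 1) (W j) : TruncAlg q (k + 1))
            = 1 + ∑ I : Fin k → Fin q,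
              ((ε : ℤ) ^ k *
                pairing (m' I) (pushH2 (quotProj (relSubgroup k W) (lcs q k)
                  (relSubgroup_le_lcs hW)) h)) • truncMonomial (k + 1) (List.ofFn I) := by
  have hRk : relSubgroup k W ≤ lcs q k := relSubgroup_le_lcs hW
  refine ⟨fun ℓ hℓ hℓk I => masseyProduct_alpha_eq_zero hℓ _ _
    (hRk.trans (Subgroup.lowerCentralSeries_antitone _ (by omega))) ε I, ?_⟩
  choose b hb hlift hm using exists_masseyProduct_alpha_eq (by omega : 2 ≤ k) (relSubgroup k W)
    (relSubgroup_le_commutator hk hW) hRk ε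
  choose b' hb' hlift' hm' using exists_masseyProduct_alpha_eq (by omega : 2 ≤ k) (lcs q k)
    (lcs_le_commutator (le_of_lt hk)) le_rfl ε
  refine ⟨_, _, hm, hm', fun j h hh => ⟨?_, ?_⟩⟩
  · simp only [fun I => (hlift I).pairing_eq (by omega) (hb I) hh]
    exact magnus_eq_sum_corner (by omega) ε (hW j)
  · simp only [fun I => (hlift' I).pairing_eq (by omega) (hb' I) (hh.pushH2 hRk)]
    exact magnus_eq_sum_corner (by omega) ε (hW j)
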